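/- Let $F$ be a field of characteristic $0$, let $L$ be an $F$-vector space with basis $e_1,e_2,\dots$, and let $E$ be the infinite dimensional (unital) Grassmann algebra of $L$, with its canonical basis $B_E$ consisting of $1$ and the monomials $e_{i_1}\cdots e_{i_k}$, $i_1<\dots<i_k$, $k\ge 1$; the length of this monomial is $k$ and its support is $\{e_{i_1},\dots,e_{i_k}\}$ (the element $1$ has length $0$ and empty support). For $G=\mathbb Z$ or $G=\mathbb Z_2=\mathbb Z/2\mathbb Z$ let $F\langle X|G\rangle$ be the free unital associative algebra on variables $x_i^g$ ($g\in G$ the degree of the variable, $i$ ranging over a countably infinite set). For a $G$-graded algebra $R=\bigoplus_{g\in G}R_g$ let $T_G(R)\subseteq F\langle X|G\rangle$ be the ideal of its graded polynomial identities, that is, of the polynomials that vanish whenever each variable $x_i^g$ is replaced by an element of $R_g$; write $T_2$ for $T_{\mathbb Z_2}$. A $T_{\mathbb Z}$-ideal is a two-sided ideal of $F\langle X|\mathbb Z\rangle$ stable under all $\mathbb Z$-graded endomorphisms. Let $\pi\colon F\langle X|\mathbb Z\rangle\to F\langle X|\mathbb Z_2\rangle$ be the homomorphism with $\pi(x_i^n)=x_i^{\overline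 n}$. Let $T_{\mathbb Z}(\mathfrak V_1^{\mathbb Z})$ be the $T_{\mathbb Z}$-ideal generated by the polynomials $[x_1,x_2,x_3]=[[x_1,x_2],x_3]$ for all degrees of $x_1,x_2,x_3$, and let $T_{\mathbb Z}(\mathfrak V_2^{\mathbb Z})$ be the $T_{\mathbb Z}$-ideal generated by $[x_1,x_2]$ when the degree of $x_1$ or of $x_2$ is even and $x_1x_2+x_2x_1$ when both degrees are odd. Let $A=\bigoplus_{r\in\mathbb Z}A_r$ be an arbitrary (not necessarily homogeneous) $\mathbb Z$-grading on $E$. 1. Suppose that $S$ is an infinite set of indices such that each $e_i$, $i\in S$, is homogeneous in the grading, let $B$ be the unital subalgebra generated by the $e_i$, $i\in S$, and suppose that the grading $B=\bigoplus_r B_r$, $B_r=B\cap A_r$, is central. This means that every $e_i$, $i\in S$, is homogeneous, that $B_r\ne 0$ for every $r\in\mathbb Z$, and that for every even $h$ the component $B_h$ contains infinitely many elements of $B_E$ of even length, with pairwise disjoint supports contained in $\{e_i\mid i\in S\}$. Let $E_d$ be $B$ with the induced $\mathbb Z_2$-grading, whose components are $\bigoplus_{r\text{ even}}B_r$ and $\bigoplus_{r\text{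 odd}}B_r$. Then $$T_{\mathbb Z}(A)\subseteq\{f\in F\langle X|\mathbb Z\rangle\mid \pi(f)\in T_2(E_d)\}.$$ 2. In particular, suppose that there are integers $m<0<n$ with $\gcd(m,n)=1$ such that $L\cap A_m$ and $L\cap A_n$ are both infinite dimensional (for instance, such that infinitely many $e_i$ lie in $A_m$ and infinitely many in $A_n$). Then one of the following holds: (a) $mn$ is even and $T_{\mathbb Z}(A)=T_{\mathbb Z}(\mathfrak V_1^{\mathbb Z})$; or (b) $mn$ is odd and $T_{\mathbb Z}(A)\subseteq T_{\mathbb Z}(\mathfrak V_2^{\mathbb Z})$. -/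

import Mathlib

namespace GradedGrassmann

section FreeAlg

variable (F : Type*) [Field F] {G : Type*} [AddCommGroup G]

/-- The free associative unital algebra on the variables `x_i^g`, where `g : G` is the degree of the
variable and `i : ℕ` is its index. -/
abbrev FreeGr (F : Type*) [Field F] (G : Type*) : Type _ := FreeAlgebra F (G × ℕ)

/-- The variable `x_i^g`. -/
noncomputable def X (g : G) (i : ℕ) : FreeGr F G := FreeAlgebra.ι F (g, i)

/-- The homogeneous component of degree `g` of the free algebra: the span of all words whose
letters have degrees adding up to `g`. -/
noncomputable def freeComponent (g : G) : Submodule F (FreeGr F G) :=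
  Submodule.span F
    {f | ∃ w : List (G × ℕ), (w.map Prod.fst).sum = g ∧ f = (w.map (FreeAlgebra.ι F)).prod}

/-- Graded endomorphisms of the free algebra. -/
def IsGradedEndo (φ : FreeGr F G →ₐ[F] FreeGr F G) : Prop :=
  ∀ g : G, ∀ f ∈ freeComponent F g, φ f ∈ freeComponent F g

/-- A `T_G`-ideal: a two-sided ideal stable under all graded endomorphisms. -/
def IsTIdeal (I : TwoSidedIdeal (FreeGr F G)) : Prop :=
  ∀ φ : FreeGr F G →ₐ[F] FreeGr F G, IsGradedEndo F φ → ∀ f ∈ I, φ f ∈ I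

/-- The `T_G`-ideal generated by a set of graded polynomials. This is the ideal of graded
identities of the variety of `G`-graded algebras defined by the set. -/
noncomputable def tIdealSpan (s : Set (FreeGr F G)) : TwoSidedIdeal (FreeGr F G) :=
  sInf {I | IsTIdeal F I ∧ ∀ f ∈ s, f ∈ I}

/-- The homomorphism `π` with `π (x_i^n) = x_i^{n mod 2}`. -/
noncomputable def reduceMod2 : FreeGr F ℤ →ₐ[F] FreeGr F (ZMod 2) :=
  FreeAlgebra.lift F fun p : ℤ × ℕ => X F (p.1 : ZMod 2) p.2

/-- The ideal of identities of the variety `𝔙₁` of `ℤ`-graded algebras, defined by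
`[x₁, x₂, x₃] = [[x₁, x₂], x₃]` for all degrees of the variables. -/
noncomputable def identitiesV1 : TwoSidedIdeal (FreeGr F ℤ) :=
  tIdealSpan F {f | ∃ p q r : ℤ, f = ⁅⁅X F p 1, X F q 2⁆, X F r 3⁆}

/-- The ideal of identities of the variety `𝔙₂` of `ℤ`-graded algebras, defined by
`[x₁, x₂]` if one of the degrees is even, and `x₁ x₂ + x₂ x₁` if both degrees are odd. -/
noncomputable def identitiesV2 : TwoSidedIdeal (FreeGr F ℤ) :=
  tIdealSpan F
    ({f | ∃ p q : ℤ, (Even p ∨ Even q) ∧ f = ⁅X F p 1, X F q 2⁆} ∪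
     {f | ∃ p q : ℤ, Odd p ∧ Odd q ∧ f = X F p 1 * X F q 2 + X F q 2 * X F p 1})

end FreeAlg

section Gradings

variable {F : Type*} [Field F] {R : Type*} [Ring R] [Algebra F R]

/-- The ideal `T_G(R)` of graded polynomial identities of an algebra `R` with homogeneous
components `𝒜 g`: the polynomials which vanish under every substitution of the variables `x_i^g`
by elements of `𝒜 g`. -/
noncomputable def gradedIdentities {G : Type*} (𝒜 : G → Submodule F R) : TwoSidedIdeal (FreeGr F G) :=
  ⨅ a : {a : G × ℕ → R // ∀ g i, a (g, i) ∈ 𝒜 g}, TwoSidedIdeal.ker (FreeAlgebra.lift F a.1)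

/-- Membership in `gradedIdentities`. -/
theorem mem_gradedIdentities {G : Type*} (𝒜 : G → Submodule F R) (f : FreeGr F G) :
    f ∈ gradedIdentities 𝒜 ↔
      ∀ a : G × ℕ → R, (∀ g i, a (g, i) ∈ 𝒜 g) → FreeAlgebra.lift F a f = 0 := by
  simp [gradedIdentities, TwoSidedIdeal.mem_iInf, TwoSidedIdeal.mem_ker]

/-- The components `B ∩ A_g` of a subalgebra `B` of a graded algebra, as subspaces of `B`. -/
def restrictGrading {G : Type*} (B : Subalgebra F R) (𝒜 : G → Submodule F R) :
    G → Submodule F B :=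
  fun g => (𝒜 g).comap B.val.toLinearMap

/-- The `ℤ/2ℤ`-grading induced by a `ℤ`-grading: the component of degree `c` is the sum of the
components `𝒜 r` with `r` in the class `c`. -/
def inducedMod2 (𝒜 : ℤ → Submodule F R) : ZMod 2 → Submodule F R :=
  fun c => ⨆ r : {r : ℤ // (r : ZMod 2) = c}, 𝒜 r.1

end Gradings

section Grassmann

variable (F : Type*) [Field F]

/-- The infinite dimensional Grassmann algebra `E` of a vector space with countable basis. -/
abbrev E : Type _ := ExteriorAlgebra F (ℕ →₀ F)

/-- The generator `e_i` of `E`. -/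
noncomputable def e (i : ℕ) : E F := ExteriorAlgebra.ι F (Finsupp.single i 1)

/-- The vector space `L` with basis `e_0, e_1, …`, inside `E`. -/
noncomputable def L : Submodule F (E F) := LinearMap.range (ExteriorAlgebra.ι F)

/-- The canonical basis element `e_{i_1} ⋯ e_{i_k}` (`i_1 < ⋯ < i_k`) whose support is `t`;
its length is `t.card`. -/
noncomputable def basisMonomial (t : Finset ℕ) : E F := ((t.sort (· ≤ ·)).map (e F)).prod

/-- The (unital) subalgebra generated by the `e_i` with `i ∈ S`. -/
noncomputable def subGrassmann (S : Set ℕ) : Subalgebra F (E F) := Algebra.adjoin F (e F '' S)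

variable {F} in
/-- A `ℤ`-grading with components `ℬ r` on the Grassmann algebra generated by the `e_i`, `i ∈ S`,
is central if it is homogeneous (every generator is homogeneous), of full support, and if each
component of even degree contains infinitely many canonical monomials of even length with pairwise
disjoint supports. -/
structure IsCentral (S : Set ℕ) (ℬ : ℤ → Submodule F (subGrassmann F S)) : Prop where
  homogeneous : ∀ i ∈ S, ∃ r : ℤ, ∃ b ∈ ℬ r, (b : E F) = e F i
  full_support : ∀ r : ℤ, ℬ r ≠ ⊥
  central : ∀ h : ℤ, Even h → ∃ T : Set (Finset ℕ), T.Infinite ∧ T.PairwiseDisjoint id ∧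
    ∀ t ∈ T, (t : Set ℕ) ⊆ S ∧ Even t.card ∧ ∃ b ∈ ℬ h, (b : E F) = basisMonomial F t

end Grassmann

end GradedGrassmann

/-
Let the central square-zero elements of `A h` have no common nonzero annihilated element, and let
`f` be an identity of `A`. Substituting `c + b * v` with `c ∈ A g`, `b ∈ A (g - h)` and `v ∈ A h`
central for a variable of degree `g` gives a polynomial in `v` all of whose values vanish;
replacing `v` by `v + u` with `u` central and square-zero kills its derivative too, so it is zero,
and its value at `v = 1` vanishes. Hence the variable may range over `A g + A (g - h)`. In a
central grading this applies to every even `h`.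

If `A m` and `A n` contain infinitely many independent vectors for coprime `m < 0 < n`, then
products of an even number of them provide such central elements in every even degree, and in all
degrees when `m * n` is even. In the latter case every variable ranges over the whole Grassmann
algebra, and modulo triple commutators a polynomial has a normal form that is determined by its
value at the generic elements `t_i + e_i`. When `m * n` is odd, the variables of even degree may be
replaced by scalars and those of odd degree by vectors of degree `m`, and these substitutions
detect every polynomial that is nonzero in the free supercommutative algebra.
-/

namespace GradedGrassmann

section Elimination

/-- No nonzero element of the ring is annihilated by all central square-zero elements of `M`. For a
component of a grading this replaces the infinitely many disjoint monomials of even length in the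
definition of a central grading. -/
def HasFaithfulCentralSquareZero {R S : Type*} [Ring R] [SetLike S R] (M : S) : Prop :=
  ∀ x : R, x ≠ 0 → ∃ u ∈ M, u ∈ Subring.center R ∧ u * u = 0 ∧ u * x ≠ 0

variable {R : Type*} [Ring R]

theorem commute_of_mem_center {u : R} (hu : u ∈ Subring.center R) (y : R) : Commute u y :=
  (Subring.mem_center_iff.1 hu y).symm

theorem add_pow_of_central_sq_zero {u : R} (hu : u ∈ Subring.center R) (hu2 : u * u = 0) (v : R)
    (n : ℕ) : (v + u) ^ n = v ^ n + n * v ^ (n - 1) * u := by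
  induction n with
  | zero => simp
  | succ n ih =>
    have hvu : n * v ^ (n - 1) * u * v = n * v ^ n * u := by
      rw [mul_assoc, (commute_of_mem_center hu v).eq, ← mul_assoc, mul_assoc (n : R)]
      rcases n with _ | n <;> simp [pow_succ]
    calc (v + u) ^ (n + 1)
        = v ^ (n + 1) + v ^ n * u + n * v ^ (n - 1) * u * v + n * v ^ (n - 1) * (u * u) := by
          rw [pow_succ, ih, pow_succ]; noncomm_ring
      _ = v ^ (n + 1) + (n + 1 : ℕ) * v ^ (n + 1 - 1) * u := by
          rw [hvu, hu2]; push_cast [Nat.add_sub_cancel]; noncomm_ring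

theorem eval_add_of_central_sq_zero {u : R} (hu : u ∈ Subring.center R) (hu2 : u * u = 0)
    (P : Polynomial R) (v : R) : P.eval (v + u) = P.eval v + P.derivative.eval v * u := by
  induction P using Polynomial.induction_on' with
  | add p q hp hq =>
    simp only [Polynomial.eval_add, Polynomial.derivative_add, hp, hq]
    noncomm_ring
  | monomial n a =>
    simp only [Polynomial.derivative_monomial, Polynomial.eval_monomial,
      add_pow_of_central_sq_zero hu hu2, mul_add, mul_assoc]

/-- Replacing `v` by `v + u` with `u` central and square-zero shows that the derivative vanishes at
`v` as well, so the degree can be lowered. -/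
theorem polynomial_eq_zero_of_eval_center [IsAddTorsionFree R] {S : Type*} [SetLike S R]
    [AddSubmonoidClass S R] {M : S} (hM : HasFaithfulCentralSquareZero M) (P : Polynomial R)
    (hP : ∀ v ∈ M, v ∈ Subring.center R → P.eval v = 0) : P = 0 := by
  induction hn : P.natDegree using Nat.strong_induction_on generalizing P with
  | _ n ih =>
    have derivative_eval : ∀ v ∈ M, v ∈ Subring.center R → P.derivative.eval v = 0 := by
      intro v hv hvc
      by_contra hne
      obtain ⟨u, hu, huc, hu2, hux⟩ := hM _ hne
      have taylor := eval_add_of_central_sq_zero huc hu2 P v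
      rw [hP v hv hvc, hP _ (add_mem hv hu) (add_mem hvc huc), zero_add,
        ← (commute_of_mem_center huc _).eq] at taylor
      exact hux taylor.symm
    have degree_zero : P.natDegree = 0 := by
      by_contra h0
      have := ih _ (hn ▸ Polynomial.natDegree_derivative_lt h0) _ derivative_eval rfl
      exact h0 (Polynomial.derivative_eq_zero.1 this)
    have h := hP 0 (zero_mem _) (zero_mem _)
    rw [Polynomial.eq_C_of_natDegree_eq_zero degree_zero] at h ⊢
    simpa using h

variable {F : Type*} [Field F] [Algebra F R] {σ : Type*}

theorem algHom_lift_apply {S : Type*} [Ring S] [Algebra F S] (ρ : R →ₐ[F] S) (a : σ → R)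
    (f : FreeAlgebra F σ) :
    ρ (FreeAlgebra.lift F a f) = FreeAlgebra.lift F (fun i => ρ (a i)) f := by
  rw [← AlgHom.comp_apply]
  congr 1
  ext i
  simp

theorem exists_finset_lift_congr (R : Type*) [Ring R] [Algebra F R] (f : FreeAlgebra F σ) :
    ∃ s : Finset σ, ∀ a b : σ → R, (∀ i ∈ s, a i = b i) →
      FreeAlgebra.lift F a f = FreeAlgebra.lift F b f := by
  classical
  induction f using FreeAlgebra.induction with
  | grade0 r => exact ⟨∅, fun a b _ => by simp⟩
  | grade1 i => exact ⟨{i}, fun a b h => by simpa using h⟩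
  | mul f g hf hg =>
    obtain ⟨s, hs⟩ := hf
    obtain ⟨t, ht⟩ := hg
    refine ⟨s ∪ t, fun a b h => ?_⟩
    rw [map_mul, map_mul, hs a b fun i hi => h i (Finset.mem_union_left _ hi),
      ht a b fun i hi => h i (Finset.mem_union_right _ hi)]
  | add f g hf hg =>
    obtain ⟨s, hs⟩ := hf
    obtain ⟨t, ht⟩ := hg
    refine ⟨s ∪ t, fun a b h => ?_⟩
    rw [map_add, map_add, hs a b fun i hi => h i (Finset.mem_union_left _ hi),
      ht a b fun i hi => h i (Finset.mem_union_right _ hi)]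

theorem exists_polynomial_eval_eq_lift_update [DecidableEq σ] (f : FreeAlgebra F σ) (a : σ → R)
    (q : σ) (y b : R) : ∃ P : Polynomial R, ∀ v ∈ Subring.center R,
      P.eval v = FreeAlgebra.lift F (Function.update a q (y + b * v)) f := by
  set A : σ → Polynomial R :=
    Function.update (fun i => Polynomial.C (a i)) q (.C y + .C b * .X) with hA
  refine ⟨FreeAlgebra.lift F A f, fun v hv => ?_⟩
  let evalₐ : Polynomial R →ₐ[F] R := Polynomial.eval₂AlgHom (AlgHom.id F R) v
    fun r => (commute_of_mem_center hv r).symm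
  have evalₐ_apply (Q : Polynomial R) : evalₐ Q = Q.eval v := rfl
  rw [← evalₐ_apply, algHom_lift_apply]
  congr 2
  ext i
  rcases eq_or_ne i q with rfl | hi <;> simp_all

variable {G : Type*} [AddCommGroup G]

/-- The subspaces `⨁_{g - r ∈ H} A_r`. For a subgroup `H` of `G` this is the `G ⧸ H`-grading
induced by `A`, indexed by representatives of the cosets. -/
def coarsening (H : Set G) (A : G → Submodule F R) (g : G) : Submodule F R :=
  ⨆ r : {r : G // g - r ∈ H}, A r

theorem le_coarsening {H : Set G} (A : G → Submodule F R) {g r : G} (hr : g - r ∈ H) :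
    A r ≤ coarsening H A g :=
  le_iSup (fun r : {r : G // g - r ∈ H} => A r) ⟨r, hr⟩

theorem coarsening_univ {A : G → Submodule F R} (hA : ⨆ r, A r = ⊤) (g : G) :
    coarsening Set.univ A g = ⊤ :=
  eq_top_iff.2 (hA ▸ iSup_le fun r => le_coarsening A (Set.mem_univ (g - r)))

variable [IsAddTorsionFree R] {A : G → Submodule F R} [SetLike.GradedMonoid A] {H : Set G}

theorem lift_update_add_eq_zero [DecidableEq σ] {f : FreeAlgebra F σ} {a : σ → R} {q : σ} {g r : G}
    (hA : HasFaithfulCentralSquareZero (A (g - r))) {b y : R} (hb : b ∈ A r)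
    (hy : ∀ c ∈ A g, FreeAlgebra.lift F (Function.update a q (c + y)) f = 0) :
    FreeAlgebra.lift F (Function.update a q (y + b)) f = 0 := by
  obtain ⟨P, hP⟩ := exists_polynomial_eval_eq_lift_update f a q y b
  have P_eq_zero : P = 0 := polynomial_eq_zero_of_eval_center hA P fun v hv hvc => by
    rw [hP v hvc, add_comm]
    exact hy _ (by simpa using SetLike.mul_mem_graded hb hv)
  simpa [P_eq_zero] using (hP 1 (one_mem _)).symm

theorem lift_update_eq_zero_of_mem_coarsening [DecidableEq σ]
    (hA : ∀ h ∈ H, HasFaithfulCentralSquareZero (A h)) {f : FreeAlgebra F σ} {a : σ → R} {q : σ}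
    {g : G} (hg : ∀ c ∈ A g, FreeAlgebra.lift F (Function.update a q c) f = 0) {y : R}
    (hy : y ∈ coarsening H A g) : FreeAlgebra.lift F (Function.update a q y) f = 0 := by
  suffices h : ∀ x : R, (∀ c ∈ A g, FreeAlgebra.lift F (Function.update a q (c + x)) f = 0) →
      ∀ c ∈ A g, FreeAlgebra.lift F (Function.update a q (c + (x + y))) f = 0 by
    simpa using h 0 (by simpa using hg) 0 (zero_mem _)
  induction hy using Submodule.iSup_induction' with
  | mem r b hb =>
    intro x hx c hc
    rw [← add_assoc]
    refine lift_update_add_eq_zero (hA _ r.2) hb fun c' hc' => ?_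
    rw [← add_assoc]
    exact hx _ (add_mem hc' hc)
  | zero => simp
  | add y z _ _ ihy ihz =>
    intro x hx
    simpa only [add_assoc] using ihz _ (ihy x hx)

theorem gradedIdentities_le_coarsening (hA : ∀ h ∈ H, HasFaithfulCentralSquareZero (A h)) :
    gradedIdentities A ≤ gradedIdentities (coarsening H A) := by
  classical
  intro f hf
  have eliminate (s : Finset (G × ℕ)) : ∀ a : G × ℕ → R, (∀ q ∈ s, a q ∈ coarsening H A q.1) →
      (∀ q ∉ s, a q ∈ A q.1) → FreeAlgebra.lift F a f = 0 := by
    induction s using Finset.induction_on with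
    | empty =>
      exact fun a _ ha => (mem_gradedIdentities A f).1 hf a fun g i =>
        ha (g, i) (Finset.notMem_empty _)
    | insert q s hq ih =>
      intro a has ha
      rw [← Function.update_eq_self q a]
      refine lift_update_eq_zero_of_mem_coarsening hA (fun c hc => ih _ ?_ ?_)
        (has q (Finset.mem_insert_self q s))
      · intro p hp
        rw [Function.update_of_ne (ne_of_mem_of_not_mem hp hq)]
        exact has p (Finset.mem_insert_of_mem hp)
      · intro p hp
        rcases eq_or_ne p q with rfl | hpq
        · rwa [Function.update_self]
        · rw [Function.update_of_ne hpq]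
          exact ha p (by simp [hpq, hp])
  rw [mem_gradedIdentities]
  intro a ha
  obtain ⟨s, hs⟩ := exists_finset_lift_congr R f
  rw [hs a (s.piecewise a 0) fun q hq => (s.piecewise_eq_of_mem a 0 hq).symm]
  refine eliminate s _ (fun q hq => ?_) fun q hq => ?_
  · rw [s.piecewise_eq_of_mem a 0 hq]
    exact ha q.1 q.2
  · rw [s.piecewise_eq_of_notMem a 0 hq]
    exact zero_mem _

end Elimination

section Reduction

variable {F : Type*} [Field F] {R : Type*} [Ring R] [Algebra F R]

theorem gradedIdentities_coarsening_even_le (A : ℤ → Submodule F R) :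
    gradedIdentities (coarsening {r | Even r} A) ≤
      TwoSidedIdeal.comap (reduceMod2 F) (gradedIdentities (inducedMod2 A)) := by
  intro f hf
  rw [TwoSidedIdeal.mem_comap, mem_gradedIdentities]
  intro a ha
  simp only [reduceMod2, algHom_lift_apply, X, FreeAlgebra.lift_ι_apply]
  refine (mem_gradedIdentities _ f).1 hf _ fun g i => ?_
  refine SetLike.le_def.1 (iSup_le fun r => le_coarsening A (even_iff_two_dvd.2 ?_)) (ha g i)
  exact (ZMod.intCast_zmod_eq_zero_iff_dvd _ 2).1 (by simp [r.2])

theorem gradedIdentities_le_restrict (B : Subalgebra F R) (A : ℤ → Submodule F R) :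
    gradedIdentities (inducedMod2 A) ≤ gradedIdentities (inducedMod2 (restrictGrading B A)) := by
  intro f hf
  rw [mem_gradedIdentities]
  intro a ha
  refine Subtype.val_injective ((algHom_lift_apply B.val a f).trans
    ((mem_gradedIdentities _ f).1 hf _ fun c i => ?_))
  have map_le : inducedMod2 (restrictGrading B A) c ≤ (inducedMod2 A c).comap B.val.toLinearMap :=
    iSup_le fun r => Submodule.comap_mono (le_iSup (fun r : {r : ℤ // (r : ZMod 2) = c} => A r) r)
  exact map_le (ha c i)

end Reduction

section CentralElements

open ExteriorAlgebra (ι)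

variable {F : Type*} [Field F] {V : Type*} [AddCommGroup V] [Module F V]

theorem commute_ι_mul_ι (v w : V) (y : ExteriorAlgebra F V) : Commute (ι F v * ι F w) y := by
  have swap (v w : V) : ι F v * ι F w = -(ι F w * ι F v) :=
    eq_neg_of_add_eq_zero_left (ExteriorAlgebra.ι_add_mul_swap v w)
  induction y using ExteriorAlgebra.induction with
  | algebraMap r => exact Algebra.commute_algebraMap_right r _
  | ι z =>
    rw [commute_iff_eq, mul_assoc, swap w z, mul_neg, ← mul_assoc, swap v z, neg_mul, neg_neg,
      mul_assoc]
  | mul a b ha hb => exact ha.mul_right hb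
  | add a b ha hb => exact ha.add_right hb

theorem mem_center_of_mem_evenOdd_zero {x : ExteriorAlgebra F V}
    (hx : x ∈ CliffordAlgebra.evenOdd (0 : QuadraticForm F V) 0) : x ∈ Subring.center _ := by
  refine Subring.mem_center_iff.2 fun y => Commute.eq (Commute.symm ?_)
  induction x, hx using CliffordAlgebra.even_induction with
  | algebraMap r => exact Algebra.commute_algebraMap_left r y
  | add a b _ _ ha hb => exact ha.add_left hb
  | ι_mul_ι_mul v w a _ ha => exact (commute_ι_mul_ι v w y).mul_left ha

theorem prod_ι_mem_evenOdd (l : List V) :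
    (l.map (ι F)).prod ∈ CliffordAlgebra.evenOdd (0 : QuadraticForm F V) l.length := by
  simpa using SetLike.list_prod_map_mem_graded l (fun _ => (1 : ZMod 2)) (ι F) fun v _ =>
    CliffordAlgebra.ι_mem_evenOdd_one (0 : QuadraticForm F V) v

theorem prod_ι_mem_center {l : List V} (hl : Even l.length) :
    (l.map (ι F)).prod ∈ Subring.center (ExteriorAlgebra F V) :=
  mem_center_of_mem_evenOdd_zero
    (by simpa [ZMod.natCast_eq_zero_iff_even.2 hl] using prod_ι_mem_evenOdd (F := F) l)

theorem prod_ι_mul_self {l : List V} (hl : Even l.length) (hne : l ≠ []) :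
    (l.map (ι F)).prod * (l.map (ι F)).prod = 0 := by
  have hcomm := commute_of_mem_center (prod_ι_mem_center (F := F) hl)
  obtain ⟨v, l, rfl⟩ := List.exists_cons_of_ne_nil hne
  rw [List.map_cons, List.prod_cons] at hcomm ⊢
  rw [mul_assoc, ← (hcomm _).eq, mul_assoc, ← mul_assoc, ExteriorAlgebra.ι_sq_zero, zero_mul]

end CentralElements

section Support

open ExteriorAlgebra (ι)

variable {F : Type*} [Field F] {V : Type*} [AddCommGroup V] [Module F V]

/-- The element `x` of the exterior algebra is supported in `W` if it is killed by the contraction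
with every functional vanishing on `W`; over a field this means that `x` lies in the subalgebra
generated by `W`. -/
def IsSupportedIn (W : Submodule F V) (x : ExteriorAlgebra F V) : Prop :=
  ∀ φ ∈ W.dualAnnihilator, CliffordAlgebra.contractLeft φ x = 0

theorem contractLeft_ι_mul (φ : Module.Dual F V) (v : V) (x : ExteriorAlgebra F V) :
    CliffordAlgebra.contractLeft φ (ι F v * x) =
      φ v • x - ι F v * CliffordAlgebra.contractLeft φ x :=
  CliffordAlgebra.contractLeft_ι_mul φ v x

variable {W : Submodule F V} {x : ExteriorAlgebra F V}

theorem IsSupportedIn.mono {W' : Submodule F V} (h : W ≤ W') (hx : IsSupportedIn W x) :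
    IsSupportedIn W' x := fun φ hφ => hx φ (Submodule.dualAnnihilator_anti h hφ)

theorem IsSupportedIn.add {y : ExteriorAlgebra F V} (hx : IsSupportedIn W x)
    (hy : IsSupportedIn W y) : IsSupportedIn W (x + y) := fun φ hφ => by
  rw [map_add, hx φ hφ, hy φ hφ, add_zero]

theorem IsSupportedIn.ι_mul (hx : IsSupportedIn W x) {v : V} (hv : v ∈ W) :
    IsSupportedIn W (ι F v * x) := fun φ hφ => by
  rw [contractLeft_ι_mul, hx φ hφ, (Submodule.mem_dualAnnihilator φ).1 hφ v hv]
  simp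

theorem exists_fg_isSupportedIn (x : ExteriorAlgebra F V) :
    ∃ W : Submodule F V, W.FG ∧ IsSupportedIn W x := by
  induction x using CliffordAlgebra.left_induction with
  | algebraMap r =>
    exact ⟨⊥, Submodule.fg_bot, fun φ _ => CliffordAlgebra.contractLeft_algebraMap _ φ r⟩
  | add x y hx hy =>
    obtain ⟨W, hW, hWx⟩ := hx
    obtain ⟨W', hW', hWy⟩ := hy
    exact ⟨W ⊔ W', hW.sup hW', (hWx.mono le_sup_left).add (hWy.mono le_sup_right)⟩
  | ι_mul x v hx =>
    obtain ⟨W, hW, hWx⟩ := hx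
    exact ⟨W ⊔ F ∙ v, hW.sup (Submodule.fg_span_singleton v), (hWx.mono le_sup_left).ι_mul
      (Submodule.mem_sup_right (Submodule.mem_span_singleton_self v))⟩

theorem IsSupportedIn.ι_mul_ne_zero (hx : IsSupportedIn W x) (hx0 : x ≠ 0) {v : V} (hv : v ∉ W) :
    ι F v * x ≠ 0 := by
  obtain ⟨φ, hφv, hφW⟩ := Submodule.exists_le_ker_of_notMem hv
  intro h
  have := contractLeft_ι_mul φ v x
  rw [h, hx φ ((Submodule.mem_dualAnnihilator φ).2 hφW)] at this
  exact smul_ne_zero hφv hx0 (by simpa using this.symm)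

end Support

section DegreeCombinations

open ExteriorAlgebra (ι)

variable {F : Type*} [Field F] {V : Type*} [AddCommGroup V] [Module F V]

theorem exists_ι_mem_mul_ne_zero {N : Submodule F (ExteriorAlgebra F V)}
    (hN : ¬ FiniteDimensional F ↥(LinearMap.range (ι F) ⊓ N)) {x : ExteriorAlgebra F V}
    (hx : x ≠ 0) : ∃ v, ι F v ∈ N ∧ ι F v * x ≠ 0 := by
  obtain ⟨W, hW, hWx⟩ := exists_fg_isSupportedIn x
  by_contra! h
  have le_map : LinearMap.range (ι F) ⊓ N ≤ W.map (ι F) := by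
    rintro _ ⟨⟨v, rfl⟩, hv⟩
    by_contra hvW
    exact hWx.ι_mul_ne_zero hx (fun hvW' => hvW ⟨v, hvW', rfl⟩) (h v hv)
  have : FiniteDimensional F (W.map (ι F)) := Module.Finite.iff_fg.2 (hW.map _)
  exact hN (Submodule.finiteDimensional_of_le le_map)

variable {G : Type*} [AddCommGroup G] {A : G → Submodule F (ExteriorAlgebra F V)}
  [SetLike.GradedMonoid A]

theorem exists_prod_ι_mem_mul_ne_zero {x : ExteriorAlgebra F V} (hx : x ≠ 0) : ∀ ds : List G,
    (∀ d ∈ ds, ¬ FiniteDimensional F ↥(LinearMap.range (ι F) ⊓ A d)) →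
      ∃ l : List V, l.length = ds.length ∧ (l.map (ι F)).prod ∈ A ds.sum ∧
        (l.map (ι F)).prod * x ≠ 0
  | [], _ => ⟨[], rfl, by simpa using SetLike.GradedOne.one_mem, by simpa using hx⟩
  | d :: ds, hds => by
    obtain ⟨l, hlen, hmem, hne⟩ :=
      exists_prod_ι_mem_mul_ne_zero hx ds fun d hd => hds d (List.mem_cons_of_mem _ hd)
    obtain ⟨v, hv, hvne⟩ := exists_ι_mem_mul_ne_zero (hds d List.mem_cons_self) hne
    refine ⟨v :: l, by simp [hlen], ?_, ?_⟩
    · rw [List.map_cons, List.prod_cons, List.sum_cons]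
      exact SetLike.mul_mem_graded hv hmem
    · rwa [List.map_cons, List.prod_cons, mul_assoc]

theorem hasFaithfulCentralSquareZero_nsmul_add_nsmul {m n : G}
    (hm : ¬ FiniteDimensional F ↥(LinearMap.range (ι F) ⊓ A m))
    (hn : ¬ FiniteDimensional F ↥(LinearMap.range (ι F) ⊓ A n)) {p q : ℕ} (hp : 0 < p)
    (hpq : Even (p + q)) : HasFaithfulCentralSquareZero (A (p • m + q • n)) := by
  intro x hx
  obtain ⟨l, hlen, hmem, hne⟩ := exists_prod_ι_mem_mul_ne_zero (A := A) hx
    (List.replicate p m ++ List.replicate q n) fun d hd => by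
      rcases List.mem_append.1 hd with hd | hd <;> rwa [List.eq_of_mem_replicate hd]
  replace hlen : l.length = p + q := by simpa using hlen
  refine ⟨_, by simpa using hmem, prod_ι_mem_center (hlen ▸ hpq),
    prod_ι_mul_self (hlen ▸ hpq) ?_, hne⟩
  rintro rfl
  simp only [List.length_nil] at hlen
  omega

theorem exists_even_combination {m n : ℤ} (hmn : Int.gcd m n = 1) {h : ℤ}
    (hpar : Even h ∨ Even (m * n)) : ∃ a b : ℤ, a * m + b * n = h ∧ Even (a + b) := by
  obtain ⟨u, v, huv⟩ := Int.isCoprime_iff_gcd_eq_one.2 hmn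
  have bezout : h * u * m + h * v * n = h := by linear_combination h * huv
  generalize h * u = a at bezout
  generalize h * v = b at bezout
  by_cases hab : Even (a + b)
  · exact ⟨a, b, bezout, hab⟩
  have not_both_even : ¬ (Even m ∧ Even n) := fun ⟨hm, hn⟩ => by
    have := (hm.mul_left u).add (hn.mul_left v)
    rw [huv] at this
    exact Int.not_even_one this
  refine ⟨a + n, b - m, by linear_combination bezout, ?_⟩
  subst h
  simp only [Int.even_add, Int.even_sub, Int.even_mul] at *
  tauto

theorem exists_nat_combination {m n : ℤ} (hm : m < 0) (hn : 0 < n) {a b : ℤ} (hab : Even (a + b)) :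
    ∃ p q : ℕ, p * m + q * n = a * m + b * n ∧ Even (p + q) ∧ 0 < p := by
  set t := |a| + |b| + 1
  have a_shift_pos : 0 < a + 2 * t * n := by
    nlinarith [neg_abs_le a, abs_nonneg a, abs_nonneg b]
  have b_shift_nonneg : 0 ≤ b - 2 * t * m := by
    nlinarith [neg_abs_le b, abs_nonneg a, abs_nonneg b]
  obtain ⟨p, hp⟩ := Int.eq_ofNat_of_zero_le a_shift_pos.le
  obtain ⟨q, hq⟩ := Int.eq_ofNat_of_zero_le b_shift_nonneg
  refine ⟨p, q, ?_, ?_, by omega⟩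
  · rw [← hp, ← hq]
    ring
  · rw [← Int.even_coe_nat, Nat.cast_add, ← hp, ← hq]
    rw [show a + 2 * t * n + (b - 2 * t * m) = a + b + 2 * (t * (n - m)) by ring]
    exact hab.add (even_two_mul _)

theorem hasFaithfulCentralSquareZero_of_gcd_eq_one {A : ℤ → Submodule F (ExteriorAlgebra F V)}
    [SetLike.GradedMonoid A] {m n : ℤ} (hm : m < 0) (hn : 0 < n) (hmn : Int.gcd m n = 1)
    (hAm : ¬ FiniteDimensional F ↥(LinearMap.range (ι F) ⊓ A m))
    (hAn : ¬ FiniteDimensional F ↥(LinearMap.range (ι F) ⊓ A n)) {h : ℤ}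
    (hpar : Even h ∨ Even (m * n)) : HasFaithfulCentralSquareZero (A h) := by
  obtain ⟨a, b, rfl, hab⟩ := exists_even_combination hmn hpar
  obtain ⟨p, q, hpq, heven, hp⟩ := exists_nat_combination hm hn hab
  rw [← hpq]
  simpa using hasFaithfulCentralSquareZero_nsmul_add_nsmul hAm hAn hp heven

end DegreeCombinations

section CentralGradings

open ExteriorAlgebra (ι)

theorem exists_mem_nonempty_disjoint {α : Type*} {T : Set (Finset α)} (hT : T.Infinite)
    (hd : T.PairwiseDisjoint id) (s : Finset α) : ∃ t ∈ T, t.Nonempty ∧ Disjoint t s := by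
  rcases isEmpty_or_nonempty α with _ | _
  · exact absurd (Set.toFinite T) hT
  by_contra! h
  choose! g hgt hgs using fun t (ht : t ∈ T \ {∅}) =>
    Finset.not_disjoint_iff.1 (h t ht.1 (Finset.nonempty_iff_ne_empty.2 ht.2))
  have g_injOn : Set.InjOn g (T \ {∅}) := fun t ht t' ht' heq =>
    hd.elim_finset ht.1 ht'.1 (g t) (hgt t ht) (heq ▸ hgt t' ht')
  exact (hT.sdiff (Set.finite_singleton ∅)) (Set.Finite.of_injOn hgs g_injOn s.finite_toSet)

variable {F : Type*} [Field F] {σ : Type*}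

theorem exists_finset_isSupportedIn (x : ExteriorAlgebra F (σ →₀ F)) :
    ∃ s : Finset σ, IsSupportedIn (Finsupp.supported F F (s : Set σ)) x := by
  classical
  obtain ⟨_, ⟨B, rfl⟩, hx⟩ := exists_fg_isSupportedIn x
  refine ⟨B.biUnion Finsupp.support, hx.mono (Submodule.span_le.2 fun w hw => ?_)⟩
  exact (Finsupp.mem_supported F w).2
    (Finset.coe_subset.2 (Finset.subset_biUnion_of_mem Finsupp.support hw))

theorem prod_ι_single_mul_ne_zero {x : ExteriorAlgebra F (σ →₀ F)} (hx : x ≠ 0) {s : Set σ}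
    (hs : IsSupportedIn (Finsupp.supported F F s) x) :
    ∀ l : List σ, l.Nodup → (∀ i ∈ l, i ∉ s) →
      IsSupportedIn (Finsupp.supported F F (s ∪ {i | i ∈ l}))
          ((l.map fun i => ι F (Finsupp.single i 1)).prod * x) ∧
        (l.map fun i => ι F (Finsupp.single i 1)).prod * x ≠ 0
  | [], _, _ => by simpa using ⟨hs, hx⟩
  | i :: l, hl, hls => by
    obtain ⟨hil, hl⟩ := List.nodup_cons.1 hl
    obtain ⟨hsupp, hne⟩ :=
      prod_ι_single_mul_ne_zero hx hs l hl fun j hj => hls j (List.mem_cons_of_mem _ hj)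
    rw [List.map_cons, List.prod_cons, mul_assoc]
    have i_notMem : i ∉ s ∪ {i | i ∈ l} := by simp [hil, hls i List.mem_cons_self]
    refine ⟨(hsupp.mono (Finsupp.supported_mono ?_)).ι_mul (Finsupp.single_mem_supported F 1 ?_),
      hsupp.ι_mul_ne_zero hne fun hi => i_notMem ?_⟩
    · exact Set.union_subset_union_right s fun j hj => List.mem_cons_of_mem i hj
    · exact Or.inr List.mem_cons_self
    · exact (Finsupp.mem_supported F _).1 hi (by simp)

theorem IsCentral.hasFaithfulCentralSquareZero {S : Set ℕ} {A : ℤ → Submodule F (E F)}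
    (hS : IsCentral S (restrictGrading (subGrassmann F S) A)) {h : ℤ} (hh : Even h) :
    HasFaithfulCentralSquareZero (A h) := by
  intro x hx
  obtain ⟨T, hT, hd, hTh⟩ := hS.central h hh
  obtain ⟨s, hs⟩ := exists_finset_isSupportedIn x
  obtain ⟨t, ht, ht_ne, hts⟩ := exists_mem_nonempty_disjoint hT hd s
  obtain ⟨-, heven, b, hb, hbt⟩ := hTh t ht
  let l : List (ℕ →₀ F) := t.sort.map fun i => Finsupp.single i 1
  have monomial_eq : basisMonomial F t = (l.map (ι F)).prod := by
    rw [List.map_map]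
    rfl
  have l_even : Even l.length := by simpa [l] using heven
  refine ⟨basisMonomial F t, hbt ▸ hb, monomial_eq ▸ prod_ι_mem_center l_even, ?_, ?_⟩
  · rw [monomial_eq]
    refine prod_ι_mul_self l_even (List.ne_nil_of_length_pos ?_)
    simpa [l] using ht_ne
  · exact (prod_ι_single_mul_ne_zero hx hs _ (t.sort_nodup _) fun i hi =>
      Finset.disjoint_left.1 hts ((Finset.mem_sort _).1 hi)).2

end CentralGradings

section CentralPolynomial

variable {F : Type*} [Field F] {R : Type*} [Ring R] [Algebra F R]

/-- Polynomials in commuting central variables indexed by `κ` with coefficients in a possibly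
noncommutative algebra `Λ` (`MvPolynomial` requires commutative coefficients). -/
abbrev CentralPolynomial (κ Λ : Type*) [Semiring Λ] : Type _ := AddMonoidAlgebra Λ (κ →₀ ℕ)

namespace CentralPolynomial

open AddMonoidAlgebra (single single_mul_single)

variable {κ Λ : Type*} [Ring Λ] [Algebra F Λ]

/-- The variable with index `i`. -/
noncomputable def var (i : κ) : CentralPolynomial κ Λ := single (Finsupp.single i 1) 1

variable (F κ Λ) in
/-- The inclusion of the coefficients as constant polynomials. -/
noncomputable def const : Λ →ₐ[F] CentralPolynomial κ Λ := AddMonoidAlgebra.singleZeroAlgHom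

theorem commute_var (i : κ) (P : CentralPolynomial κ Λ) : Commute (var i) P :=
  AddMonoidAlgebra.single_commute (fun _ => AddCommute.all _ _) Commute.one_left P

theorem coeff_const_mul (ω : Λ) (P : CentralPolynomial κ Λ) (α : κ →₀ ℕ) :
    (const F κ Λ ω * P).coeff α = ω * P.coeff α :=
  AddMonoidAlgebra.coeff_single_zero_mul P ω α

/-- The homomorphism which is `j` on the coefficients and sends the `i`-th variable to `z i`. -/
noncomputable def aeval (j : Λ →ₐ[F] R) (z : κ → Subalgebra.center F R) :
    CentralPolynomial κ Λ →ₐ[F] R :=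
  AddMonoidAlgebra.liftNCAlgHom j
    ((((Subalgebra.center F R).val.comp (MvPolynomial.aeval z)) : MvPolynomial κ F →* R).comp
      (MvPolynomial.monomialOneHom F κ))
    fun ω _ => (Subalgebra.mem_center_iff.1 (Subtype.prop _) (j ω))

theorem aeval_single (j : Λ →ₐ[F] R) (z : κ → Subalgebra.center F R) (α : κ →₀ ℕ) (ω : Λ) :
    aeval j z (single α ω) = j ω * (MvPolynomial.aeval z (MvPolynomial.monomial α (1 : F)) : R) :=
  AddMonoidAlgebra.liftNC_single _ _ _ _

@[simp]
theorem aeval_var (j : Λ →ₐ[F] R) (z : κ → Subalgebra.center F R) (i : κ) :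
    aeval j z (var i) = z i := by
  rw [var, aeval_single, map_one, one_mul, ← MvPolynomial.X, MvPolynomial.aeval_X]

@[simp]
theorem aeval_const (j : Λ →ₐ[F] R) (z : κ → Subalgebra.center F R) (ω : Λ) :
    aeval j z (const F κ Λ ω) = j ω := by
  rw [const, AddMonoidAlgebra.singleZeroAlgHom_apply, aeval_single]
  simp

/-- The specialization of the variables to the scalars `c`. -/
noncomputable def eval (c : κ → F) : CentralPolynomial κ Λ →ₐ[F] Λ :=
  aeval (AlgHom.id F Λ) fun i => algebraMap F _ (c i)

@[simp]
theorem eval_var (c : κ → F) (i : κ) :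
    eval c (var i : CentralPolynomial κ Λ) = algebraMap F Λ (c i) :=
  aeval_var _ _ i

@[simp]
theorem eval_const (c : κ → F) (ω : Λ) : eval c (const F κ Λ ω) = ω :=
  aeval_const _ _ ω

theorem eval_single (c : κ → F) (α : κ →₀ ℕ) (ω : Λ) :
    eval c (single α ω) = MvPolynomial.eval c (MvPolynomial.monomial α 1) • ω := by
  have aeval_eq : MvPolynomial.aeval (fun i => algebraMap F (Subalgebra.center F Λ) (c i))
      (MvPolynomial.monomial α (1 : F)) = algebraMap F _ (MvPolynomial.eval c (.monomial α 1)) := by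
    rw [← MvPolynomial.coe_aeval_eq_eval]
    exact MvPolynomial.aeval_algebraMap_apply _ c _
  rw [eval, aeval_single, aeval_eq, Algebra.smul_def, Algebra.commutes]
  rfl

theorem dual_eval (φ : Module.Dual F Λ) (c : κ → F) (P : CentralPolynomial κ Λ) :
    φ (eval c P) =
      MvPolynomial.eval c (AddMonoidAlgebra.map φ.toAddMonoidHom P : MvPolynomial κ F) := by
  induction P using AddMonoidAlgebra.induction_linear with
  | zero => simp
  | add P Q hP hQ => rw [map_add, map_add, hP, hQ, AddMonoidAlgebra.map_add, map_add]
  | single α ω =>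
    rw [eval_single, map_smul, AddMonoidAlgebra.map_single]
    change _ = MvPolynomial.eval c (MvPolynomial.monomial α (φ ω))
    simp [MvPolynomial.eval_monomial, mul_comm]

theorem eq_zero_of_forall_eval_eq_zero [Infinite F] {P : CentralPolynomial κ Λ}
    (hP : ∀ c : κ → F, eval c P = 0) : P = 0 := by
  ext α
  refine (Module.forall_dual_apply_eq_zero_iff F _).1 fun φ => ?_
  have map_eq_zero : (AddMonoidAlgebra.map φ.toAddMonoidHom P : MvPolynomial κ F) = 0 :=
    MvPolynomial.funext fun c => by rw [← dual_eval, hP, map_zero, map_zero]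
  exact congr(MvPolynomial.coeff α $map_eq_zero)

theorem lift_eq_zero_of_forall_eval [Infinite F] {τ : Type*} {a : τ → CentralPolynomial κ Λ}
    {f : FreeAlgebra F τ} (h : ∀ c : κ → F, FreeAlgebra.lift F (fun i => eval c (a i)) f = 0) :
    FreeAlgebra.lift F a f = 0 :=
  eq_zero_of_forall_eval_eq_zero fun c => (algHom_lift_apply (eval c) a f).trans (h c)

end CentralPolynomial

end CentralPolynomial

section Supercommutative

open ExteriorAlgebra (ι)

variable {F : Type*} [Field F] {R : Type*} [Ring R] [Algebra F R] {τ : Type*}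

theorem exists_algHom_exteriorAlgebra [NeZero (2 : F)] {y : τ → R}
    (hy : ∀ i j, y i * y j + y j * y i = 0) :
    ∃ j : ExteriorAlgebra F (τ →₀ F) →ₐ[F] R, ∀ i, j (ι F (Finsupp.single i 1)) = y i := by
  set φ := Finsupp.linearCombination F y
  have anticommute :
      (LinearMap.mul F R).compl₁₂ φ φ + ((LinearMap.mul F R).compl₁₂ φ φ).flip = 0 := by
    ext i j
    simpa [φ] using hy i j
  have sq_zero (v : τ →₀ F) : φ v * φ v = 0 := by
    have : (2 : F) • (φ v * φ v) = 0 := by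
      rw [two_smul]
      exact congr($anticommute v v)
    exact (smul_eq_zero.1 this).resolve_left two_ne_zero
  exact ⟨ExteriorAlgebra.lift F ⟨φ, sq_zero⟩, fun i => by simp [φ]⟩

variable (F) in
open Classical in
/-- The generators of the free supercommutative algebra, realized inside polynomials over the
exterior algebra: variables for the indices satisfying `even`, and exterior generators for the
others. -/
noncomputable def superGenerator (even : τ → Prop) (i : τ) :
    CentralPolynomial τ (ExteriorAlgebra F (τ →₀ F)) :=
  if even i then .var i else .const F τ _ (ι F (Finsupp.single i 1))

theorem exists_algHom_superGenerator [NeZero (2 : F)] {even : τ → Prop} {w : τ → R}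
    (heven : ∀ i, even i → w i ∈ Subring.center R)
    (hodd : ∀ i j, ¬ even i → ¬ even j → w i * w j + w j * w i = 0) :
    ∃ Ψ : CentralPolynomial τ (ExteriorAlgebra F (τ →₀ F)) →ₐ[F] R,
      ∀ i, Ψ (superGenerator F even i) = w i := by
  classical
  let z (i : τ) : Subalgebra.center F R := if h : even i then ⟨w i, heven i h⟩ else 0
  obtain ⟨j, hj⟩ := exists_algHom_exteriorAlgebra (F := F)
    (y := fun i => if even i then 0 else w i) fun i k => by
      by_cases hi : even i <;> by_cases hk : even k <;> simp [hi, hk, hodd]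
  refine ⟨CentralPolynomial.aeval j z, fun i => ?_⟩
  by_cases hi : even i <;> simp [superGenerator, hi, hj, z]

theorem lift_eq_zero_of_lift_eval_superGenerator [CharZero F] {even : τ → Prop} {w : τ → R}
    (heven : ∀ i, even i → w i ∈ Subring.center R)
    (hodd : ∀ i j, ¬ even i → ¬ even j → w i * w j + w j * w i = 0) {f : FreeAlgebra F τ}
    (hf : ∀ c : τ → F,
      FreeAlgebra.lift F (fun i => CentralPolynomial.eval c (superGenerator F even i)) f = 0) :
    FreeAlgebra.lift F w f = 0 := by
  obtain ⟨Ψ, hΨ⟩ := exists_algHom_superGenerator (F := F) heven hodd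
  rw [← funext hΨ, ← algHom_lift_apply, CentralPolynomial.lift_eq_zero_of_forall_eval hf, map_zero]

end Supercommutative

theorem span_prod_map_ι (F τ : Type*) [Field F] :
    Submodule.span F (Set.range fun l : List τ => (l.map (FreeAlgebra.ι F)).prod) = ⊤ := by
  rw [← Algebra.top_toSubmodule, ← FreeAlgebra.adjoin_range_ι, Algebra.adjoin_eq_span,
    Submonoid.closure_eq_image_prod, ← Set.range_list_map, ← Set.range_comp]
  rfl

section LieNilpotent

open ExteriorAlgebra (ι)
open CliffordAlgebra (even)

attribute [local instance] LieRing.ofAssociativeRing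

variable {F : Type*} [Field F] {R : Type*} [Ring R] [Algebra F R] {τ : Type*}

theorem lie_mul_lie_eq_zero (hR : ∀ a b c : R, ⁅⁅a, b⁆, c⁆ = 0) (a b c : R) :
    ⁅a, b⁆ * ⁅b, c⁆ = 0 := by
  have leibniz : ⁅⁅a * b, c⁆, b⁆ = ⁅a, b⁆ * ⁅b, c⁆ + a * ⁅⁅b, c⁆, b⁆ + ⁅⁅a, c⁆, b⁆ * b := by
    simp only [Ring.lie_def]
    noncomm_ring
  simpa [hR] using leibniz.symm

theorem exterior_lie_lie {V : Type*} [AddCommGroup V] [Module F V]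
    (a b c : ExteriorAlgebra F V) : ⁅⁅a, b⁆, c⁆ = 0 := by
  have even_add_odd (x : ExteriorAlgebra F V) :
      ∃ x₀ ∈ CliffordAlgebra.evenOdd (0 : QuadraticForm F V) 0,
        ∃ x₁ ∈ CliffordAlgebra.evenOdd (0 : QuadraticForm F V) 1, x₀ + x₁ = x := by
    rw [← Submodule.mem_sup, (CliffordAlgebra.evenOdd_isCompl _).sup_eq_top]
    trivial
  obtain ⟨a₀, ha₀, a₁, ha₁, rfl⟩ := even_add_odd a
  obtain ⟨b₀, hb₀, b₁, hb₁, rfl⟩ := even_add_odd b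
  have odd_mul_odd {x y : ExteriorAlgebra F V}
      (hx : x ∈ CliffordAlgebra.evenOdd (0 : QuadraticForm F V) 1)
      (hy : y ∈ CliffordAlgebra.evenOdd (0 : QuadraticForm F V) 1) :
      x * y ∈ Subring.center (ExteriorAlgebra F V) :=
    mem_center_of_mem_evenOdd_zero
      (CliffordAlgebra.evenOdd_mul_le _ 1 1 (Submodule.mul_mem_mul hx hy))
  have lie_a₀ (y : ExteriorAlgebra F V) : ⁅a₀, y⁆ = 0 :=
    (commute_of_mem_center (mem_center_of_mem_evenOdd_zero ha₀) y).lie_eq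
  have lie_b₀ (y : ExteriorAlgebra F V) : ⁅y, b₀⁆ = 0 :=
    (commute_of_mem_center (mem_center_of_mem_evenOdd_zero hb₀) y).symm.lie_eq
  rw [add_lie, lie_a₀, lie_add, lie_b₀, zero_add, zero_add]
  exact (commute_of_mem_center (sub_mem (odd_mul_odd ha₁ hb₁) (odd_mul_odd hb₁ ha₁)) c).lie_eq

/-- The even homomorphism `(v, w) ↦ ½ [v, w]` from the exterior algebra on the indices of the
family `x` to an algebra which is Lie nilpotent of class two. -/
noncomputable def halfCommutator [CharZero F] (hR : ∀ a b c : R, ⁅⁅a, b⁆, c⁆ = 0) (x : τ → R) :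
    CliffordAlgebra.EvenHom (0 : QuadraticForm F (τ →₀ F)) (Subalgebra.center F R) where
  bilin := LinearMap.mk₂ F
    (fun v w => ⟨(2⁻¹ : F) • ⁅Finsupp.linearCombination F x v, Finsupp.linearCombination F x w⁆,
      Subalgebra.smul_mem _ (Subalgebra.mem_center_iff.2 fun r =>
        (commute_iff_lie_eq.2 (hR _ _ r)).eq.symm) _⟩)
    (fun _ _ _ => Subtype.ext <| by simp)
    (fun a _ _ => Subtype.ext <| by simp [smul_comm a (2⁻¹ : F)])
    (fun _ _ _ => Subtype.ext <| by simp)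
    (fun a _ _ => Subtype.ext <| by simp [Ring.lie_def, ← smul_sub, smul_comm a (2⁻¹ : F)])
  contract v := Subtype.ext <| by simp
  contract_mid u v w := Subtype.ext <| by simp [lie_mul_lie_eq_zero hR]

/-- The homomorphism from the even part of the exterior algebra which sends `v ∧ w`
to `½ [v, w]`. -/
noncomputable def evenPartHom [CharZero F] (hR : ∀ a b c : R, ⁅⁅a, b⁆, c⁆ = 0) (x : τ → R) :
    even (0 : QuadraticForm F (τ →₀ F)) →ₐ[F] R :=
  (Subalgebra.center F R).val.comp (even.lift _ (halfCommutator hR x))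

section NormalForm

variable [CharZero F] {hR : ∀ a b c : R, ⁅⁅a, b⁆, c⁆ = 0} {x : τ → R}

theorem commute_evenPartHom (ω : even (0 : QuadraticForm F (τ →₀ F))) (r : R) :
    Commute (evenPartHom hR x ω) r :=
  (Subalgebra.mem_center_iff.1 (even.lift _ (halfCommutator (F := F) hR x) ω).2 r).symm

theorem evenPartHom_bilin (v w : τ →₀ F) :
    evenPartHom hR x ((even.ι _).bilin v w) =
      (2⁻¹ : F) • ⁅Finsupp.linearCombination F x v, Finsupp.linearCombination F x w⁆ := by
  rw [evenPartHom, AlgHom.comp_apply, even.lift_ι]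
  rfl

variable (F hR x) in
theorem exists_evenPartHom_eq_lie (i j : τ) :
    ∃ ω : even (0 : QuadraticForm F (τ →₀ F)), evenPartHom hR x ω = ⁅x i, x j⁆ :=
  ⟨(2 : F) • (even.ι _).bilin (Finsupp.single i 1) (Finsupp.single j 1), by
    simp [evenPartHom_bilin]⟩

theorem map_evenPartHom {S : Type*} [Ring S] [Algebra F S] (hS : ∀ a b c : S, ⁅⁅a, b⁆, c⁆ = 0)
    (ρ : R →ₐ[F] S) (ω : even (0 : QuadraticForm F (τ →₀ F))) :
    ρ (evenPartHom hR x ω) = evenPartHom hS (ρ ∘ x) ω := by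
  suffices h : ρ.comp (evenPartHom hR x) = evenPartHom hS (ρ ∘ x) from DFunLike.congr_fun h ω
  refine even.algHom_ext _ (CliffordAlgebra.EvenHom.ext (LinearMap.ext₂ fun v w => ?_))
  change ρ (evenPartHom hR x ((even.ι _).bilin v w)) = evenPartHom hS (ρ ∘ x) ((even.ι _).bilin v w)
  have map_linearCombination (v : τ →₀ F) :
      ρ (Finsupp.linearCombination F x v) = Finsupp.linearCombination F (ρ ∘ x) v :=
    Finsupp.apply_linearCombination F ρ.toLinearMap x v
  simp only [evenPartHom_bilin, map_smul, Ring.lie_def, map_sub, map_mul, map_linearCombination]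

variable (F hR x) in
/-- The span of the products of fewer than `d` generators with coefficients in the algebra
generated by the commutators. -/
noncomputable def wordSpan (d : ℕ) : Submodule F R :=
  Submodule.span F {y | ∃ l : List τ, l.length < d ∧
    ∃ ω : even (0 : QuadraticForm F (τ →₀ F)), y = (l.map x).prod * evenPartHom hR x ω}

theorem word_mul_mem_wordSpan {l : List τ} {d : ℕ} (h : l.length < d)
    (ω : even (0 : QuadraticForm F (τ →₀ F))) :
    (l.map x).prod * evenPartHom hR x ω ∈ wordSpan F hR x d :=
  Submodule.subset_span ⟨l, h, ω, rfl⟩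

theorem mul_mem_wordSpan_succ (i : τ) {d : ℕ} {y : R} (hy : y ∈ wordSpan F hR x d) :
    x i * y ∈ wordSpan F hR x (d + 1) := by
  suffices wordSpan F hR x d ≤ (wordSpan F hR x (d + 1)).comap (LinearMap.mulLeft F (x i)) from
    this hy
  refine Submodule.span_le.2 ?_
  rintro _ ⟨l, hl, ω, rfl⟩
  have := word_mul_mem_wordSpan (hR := hR) (x := x) (l := i :: l) (Nat.succ_lt_succ hl) ω
  rwa [List.map_cons, List.prod_cons, mul_assoc] at this

theorem prod_sub_prod_mem_wordSpan {l l' : List τ} (h : l.Perm l') :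
    (l.map x).prod - (l'.map x).prod ∈ wordSpan F hR x l.length := by
  induction h with
  | nil => simp
  | cons i _ ih =>
    rw [List.map_cons, List.map_cons, List.prod_cons, List.prod_cons, ← mul_sub]
    exact mul_mem_wordSpan_succ i ih
  | swap i j l =>
    obtain ⟨ω, hω⟩ := exists_evenPartHom_eq_lie F hR x j i
    have := word_mul_mem_wordSpan (hR := hR) (x := x) (l := l) (d := (j :: i :: l).length)
      (by simp) ω
    rw [← (commute_evenPartHom ω _).eq, hω, Ring.lie_def, sub_mul, mul_assoc, mul_assoc] at this
    simpa using this
  | trans h _ ih ih' =>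
    rw [← h.length_eq] at ih'
    simpa using add_mem ih ih'

variable (F hR x) in
/-- The value at `x` of a normal form: a linear combination of commutative monomials, evaluated
as words in some fixed order, with coefficients in the algebra generated by the commutators. -/
noncomputable def normalForm :
    ((τ →₀ ℕ) →₀ even (0 : QuadraticForm F (τ →₀ F))) →ₗ[F] R :=
  Finsupp.lsum F fun α =>
    (LinearMap.mulLeft F ((Finsupp.toMultiset α).toList.map x).prod).comp
      (evenPartHom hR x).toLinearMap

theorem normalForm_single (α : τ →₀ ℕ) (ω : even (0 : QuadraticForm F (τ →₀ F))) :
    normalForm F hR x (Finsupp.single α ω) =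
      ((Finsupp.toMultiset α).toList.map x).prod * evenPartHom hR x ω := by
  simp [normalForm]

theorem normalForm_comp {S : Type*} [Ring S] [Algebra F S] (hS : ∀ a b c : S, ⁅⁅a, b⁆, c⁆ = 0)
    (ρ : R →ₐ[F] S) :
    ρ.toLinearMap ∘ₗ normalForm F hR x = normalForm F hS (ρ ∘ x) := by
  ext α ω
  simp [normalForm_single, map_evenPartHom hS, map_list_prod]

theorem mul_evenPartHom_mem_range_normalForm {y : R}
    (hy : y ∈ LinearMap.range (normalForm F hR x)) (ω : even (0 : QuadraticForm F (τ →₀ F))) :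
    y * evenPartHom hR x ω ∈ LinearMap.range (normalForm F hR x) := by
  obtain ⟨n, rfl⟩ := hy
  induction n using Finsupp.induction_linear with
  | zero => simp
  | add n n' h h' => simpa [add_mul] using add_mem h h'
  | single α ω' =>
    refine ⟨Finsupp.single α (ω' * ω), ?_⟩
    rw [normalForm_single, normalForm_single, map_mul, mul_assoc]

theorem word_mem_range_normalForm (l : List τ) :
    (l.map x).prod ∈ LinearMap.range (normalForm F hR x) := by
  classical
  induction hd : l.length using Nat.strong_induction_on generalizing l with
  | _ d ih =>
  have shorter : wordSpan F hR x d ≤ LinearMap.range (normalForm F hR x) := by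
    refine Submodule.span_le.2 ?_
    rintro _ ⟨l', hl', ω, rfl⟩
    exact mul_evenPartHom_mem_range_normalForm (ih _ hl' l' rfl) ω
  set α := Multiset.toFinsupp (l : Multiset τ)
  have perm : l.Perm (Finsupp.toMultiset α).toList := by
    rw [← Multiset.coe_eq_coe, Multiset.coe_toList, Multiset.toFinsupp_toMultiset]
  rw [← sub_add_cancel (l.map x).prod ((Finsupp.toMultiset α).toList.map x).prod]
  refine add_mem (shorter (hd ▸ prod_sub_prod_mem_wordSpan perm)) ⟨Finsupp.single α 1, ?_⟩
  rw [normalForm_single, map_one, mul_one]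

variable (F hR x) in
theorem exists_normalForm_eq_lift (f : FreeAlgebra F τ) :
    ∃ n, normalForm F hR x n = FreeAlgebra.lift F x f := by
  suffices (⊤ : Submodule F (FreeAlgebra F τ)) ≤
      (LinearMap.range (normalForm F hR x)).comap (FreeAlgebra.lift F x).toLinearMap from
    this Submodule.mem_top
  rw [← span_prod_map_ι, Submodule.span_le]
  rintro _ ⟨l, rfl⟩
  simpa [map_list_prod, Function.comp_def] using word_mem_range_normalForm (F := F) (hR := hR) l

end NormalForm

section GenericElements

namespace CentralPolynomial

theorem lie_lie_eq_zero {Λ κ : Type*} [Ring Λ] [Algebra F Λ] [Infinite F]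
    (hΛ : ∀ a b c : Λ, ⁅⁅a, b⁆, c⁆ = 0) (a b c : CentralPolynomial κ Λ) : ⁅⁅a, b⁆, c⁆ = 0 :=
  eq_zero_of_forall_eval_eq_zero fun s => by
    have := hΛ (eval (F := F) s a) (eval s b) (eval s c)
    simpa [Ring.lie_def] using this

end CentralPolynomial

variable (F) in
/-- The generic element `t_i + e_i` of the exterior algebra. -/
noncomputable def genericElement (i : τ) : CentralPolynomial τ (ExteriorAlgebra F (τ →₀ F)) :=
  .var i + .const F τ _ (ι F (Finsupp.single i 1))

theorem lie_genericElement (i j : τ) :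
    ⁅genericElement F i, genericElement F j⁆ = (2 : F) •
      CentralPolynomial.const F τ _ (ι F (Finsupp.single i 1) * ι F (Finsupp.single j 1)) := by
  have swap : ι F (Finsupp.single j (1 : F)) * ι F (Finsupp.single i 1) =
      -(ι F (Finsupp.single i 1) * ι F (Finsupp.single j 1)) :=
    eq_neg_of_add_eq_zero_left (ExteriorAlgebra.ι_add_mul_swap _ _)
  rw [genericElement, genericElement, add_lie, (CentralPolynomial.commute_var i _).lie_eq, lie_add,
    (CentralPolynomial.commute_var j _).symm.lie_eq, zero_add, zero_add, Ring.lie_def,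
    ← map_mul (CentralPolynomial.const F τ _), ← map_mul (CentralPolynomial.const F τ _), swap,
    map_neg, sub_neg_eq_add, two_smul]

theorem evenPartHom_genericElement [CharZero F]
    (hP : ∀ a b c : CentralPolynomial τ (ExteriorAlgebra F (τ →₀ F)), ⁅⁅a, b⁆, c⁆ = 0)
    (ω : even (0 : QuadraticForm F (τ →₀ F))) :
    evenPartHom hP (genericElement F) ω =
      CentralPolynomial.const F τ (ExteriorAlgebra F (τ →₀ F)) ω := by
  suffices h : evenPartHom hP (genericElement F) =
      (CentralPolynomial.const F τ _).comp (even (0 : QuadraticForm F (τ →₀ F))).val from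
    DFunLike.congr_fun h ω
  refine even.algHom_ext _ (CliffordAlgebra.EvenHom.ext ?_)
  ext i j : 4
  change evenPartHom hP (genericElement F)
      ((even.ι _).bilin (Finsupp.single i (1 : F)) (Finsupp.single j (1 : F))) =
    CentralPolynomial.const F τ (ExteriorAlgebra F (τ →₀ F))
      (ι F (Finsupp.single i (1 : F)) * ι F (Finsupp.single j (1 : F)))
  rw [evenPartHom_bilin, Finsupp.linearCombination_single, Finsupp.linearCombination_single,
    one_smul, one_smul, lie_genericElement, inv_smul_smul₀ two_ne_zero]

theorem coeff_prod_genericElement [DecidableEq τ] (l : List τ) (ω : ExteriorAlgebra F (τ →₀ F))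
    {α : τ →₀ ℕ} (hα : l.length ≤ α.degree) :
    ((l.map (genericElement F)).prod * CentralPolynomial.const F τ _ ω).coeff α =
      if Multiset.toFinsupp (l : Multiset τ) = α then ω else 0 := by
  induction l generalizing α with
  | nil => simp [CentralPolynomial.const, AddMonoidAlgebra.coeff_single, Finsupp.single_apply]
  | cons i l ih =>
    have toFinsupp_cons : Multiset.toFinsupp ((i :: l : List τ) : Multiset τ) =
        Finsupp.single i 1 + Multiset.toFinsupp (l : Multiset τ) := by
      rw [← Multiset.cons_coe, ← Multiset.singleton_add, map_add, Multiset.toFinsupp_singleton]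
    rw [List.length_cons] at hα
    have ne_α : Multiset.toFinsupp (l : Multiset τ) ≠ α := by
      rintro rfl
      have degree_eq : (Multiset.toFinsupp (l : Multiset τ)).degree = l.length :=
        (Multiset.toFinsupp_sum_eq (l : Multiset τ) :)
      omega
    rw [List.map_cons, List.prod_cons, mul_assoc, genericElement, add_mul,
      AddMonoidAlgebra.coeff_add, Finsupp.add_apply, CentralPolynomial.coeff_const_mul,
      ih (Nat.le_of_succ_le hα), if_neg ne_α, mul_zero, add_zero, toFinsupp_cons]
    by_cases hi : Finsupp.single i 1 ≤ α
    · obtain ⟨β, rfl⟩ := exists_add_of_le hi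
      rw [CentralPolynomial.var, AddMonoidAlgebra.coeff_single_mul_add, one_mul, ih]
      · simp only [add_right_inj]
      · simpa [add_comm 1] using hα
    · rw [CentralPolynomial.var, AddMonoidAlgebra.coeff_single_mul_of_forall_add_ne, if_neg]
      · rintro rfl
        exact hi le_self_add
      · rintro β rfl
        exact hi le_self_add

theorem normalForm_genericElement_injective [CharZero F]
    (hP : ∀ a b c : CentralPolynomial τ (ExteriorAlgebra F (τ →₀ F)), ⁅⁅a, b⁆, c⁆ = 0) :
    Function.Injective (normalForm F hP (genericElement F)) := by
  classical
  refine (injective_iff_map_eq_zero _).2 fun n hn => ?_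
  by_contra hne
  obtain ⟨α, hα, hmax⟩ :=
    n.support.exists_max_image Finsupp.degree (Finsupp.support_nonempty_iff.2 hne)
  refine Finsupp.mem_support_iff.1 hα (Subtype.ext ?_)
  have coeff_term {β : τ →₀ ℕ} (hβ : β ∈ n.support) :
      (((Finsupp.toMultiset β).toList.map (genericElement F)).prod *
        evenPartHom hP (genericElement F) (n β)).coeff α =
      if β = α then (n β : ExteriorAlgebra F (τ →₀ F)) else 0 := by
    rw [evenPartHom_genericElement, coeff_prod_genericElement, Multiset.coe_toList,
      Finsupp.toMultiset_toFinsupp]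
    rw [Multiset.length_toList, Finsupp.card_toMultiset]
    exact hmax β hβ
  have coeff_sum : (∑ β ∈ n.support, (((Finsupp.toMultiset β).toList.map (genericElement F)).prod *
      evenPartHom hP (genericElement F) (n β))).coeff α = 0 := congr(AddMonoidAlgebra.coeff $hn α)
  rwa [AddMonoidAlgebra.coeff_sum, Finsupp.finsetSum_apply,
    Finset.sum_congr rfl fun β hβ => coeff_term hβ, Finset.sum_ite_eq' _ α, if_pos hα] at coeff_sum

theorem lift_eq_zero_of_lie_lie [CharZero F] (hR : ∀ a b c : R, ⁅⁅a, b⁆, c⁆ = 0) (x : τ → R)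
    {f : FreeAlgebra F τ} (hf : ∀ a : τ → ExteriorAlgebra F (τ →₀ F), FreeAlgebra.lift F a f = 0) :
    FreeAlgebra.lift F x f = 0 := by
  have hP (a b c : CentralPolynomial τ (ExteriorAlgebra F (τ →₀ F))) : ⁅⁅a, b⁆, c⁆ = 0 :=
    CentralPolynomial.lie_lie_eq_zero (F := F) exterior_lie_lie a b c
  let y (i : τ) : R × CentralPolynomial τ (ExteriorAlgebra F (τ →₀ F)) := (x i, genericElement F i)
  have hRP (a b c : R × CentralPolynomial τ (ExteriorAlgebra F (τ →₀ F))) : ⁅⁅a, b⁆, c⁆ = 0 :=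
    Prod.ext (hR a.1 b.1 c.1) (hP a.2 b.2 c.2)
  obtain ⟨n, hn⟩ := exists_normalForm_eq_lift F hRP y f
  have lift_fst : (FreeAlgebra.lift F y f).1 = FreeAlgebra.lift F x f :=
    algHom_lift_apply (AlgHom.fst F _ _) y f
  have lift_snd : (FreeAlgebra.lift F y f).2 = 0 :=
    (algHom_lift_apply (AlgHom.snd F _ _) y f).trans
      (CentralPolynomial.lift_eq_zero_of_forall_eval fun c => hf _)
  have n_eq_zero : n = 0 := by
    apply normalForm_genericElement_injective hP
    have normalForm_snd : (normalForm F hRP y n).2 = normalForm F hP (genericElement F) n :=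
      DFunLike.congr_fun (normalForm_comp (hR := hRP) (x := y) hP (AlgHom.snd F _ _)) n
    rw [← normalForm_snd, hn, lift_snd, map_zero]
  rw [← lift_fst, ← hn, n_eq_zero, map_zero, Prod.fst_zero]

end GenericElements

end LieNilpotent

section Quotients

variable (F : Type*) [Field F]

theorem mkₐ_eq_zero_iff {R : Type*} [Ring R] [Algebra F R] {I : TwoSidedIdeal R} {x : R} :
    I.ringCon.mkₐ F x = 0 ↔ x ∈ I := by
  rw [TwoSidedIdeal.mem_iff]
  exact RingCon.eq _

variable {F} {τ : Type*}

theorem lift_mkₐ_ι (I : TwoSidedIdeal (FreeAlgebra F τ)) :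
    FreeAlgebra.lift F (fun i => I.ringCon.mkₐ F (FreeAlgebra.ι F i)) = I.ringCon.mkₐ F := by
  ext i
  simp

theorem commute_mkₐ {I : TwoSidedIdeal (FreeAlgebra F τ)} {x : FreeAlgebra F τ}
    (hx : ∀ i, ⁅x, FreeAlgebra.ι F i⁆ ∈ I) (r : I.ringCon.Quotient) :
    Commute (I.ringCon.mkₐ F x) r := by
  obtain ⟨r, rfl⟩ := RingCon.mkₐ_surjective (α := F) I.ringCon r
  induction r using FreeAlgebra.induction with
  | grade0 s => exact Algebra.commute_algebraMap_right s _
  | grade1 i =>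
    rw [commute_iff_lie_eq, Ring.lie_def, ← map_mul, ← map_mul, ← map_sub]
    exact (mkₐ_eq_zero_iff F).2 (hx i)
  | mul a b ha hb => exact ha.mul_right hb
  | add a b ha hb => exact ha.add_right hb

end Quotients

section TIdeals

variable {F : Type*} [Field F] {G : Type*} [AddCommGroup G]

instance freeComponent.gradedMonoid : SetLike.GradedMonoid (freeComponent F (G := G)) where
  one_mem := Submodule.subset_span ⟨[], rfl, rfl⟩
  mul_mem g h a b ha hb := by
    have := Submodule.mul_mem_mul ha hb
    rw [freeComponent, freeComponent, Submodule.span_mul_span] at this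
    refine Submodule.span_mono ?_ this
    rintro _ ⟨_, ⟨w, rfl, rfl⟩, _, ⟨w', rfl, rfl⟩, rfl⟩
    exact ⟨w ++ w', by simp, by simp⟩

theorem X_mem_freeComponent (g : G) (i : ℕ) : X F g i ∈ freeComponent F g :=
  Submodule.subset_span ⟨[(g, i)], by simp, by simp [X]⟩

theorem iSup_freeComponent : ⨆ g, freeComponent F (G := G) g = ⊤ := by
  rw [eq_top_iff, ← span_prod_map_ι, Submodule.span_le]
  rintro _ ⟨w, rfl⟩
  exact Submodule.mem_iSup_of_mem _ (Submodule.subset_span ⟨w, rfl, rfl⟩)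

theorem lift_mem_of_mem_freeComponent {R : Type*} [Ring R] [Algebra F R] {A : G → Submodule F R}
    [SetLike.GradedMonoid A] {a : G × ℕ → R} (ha : ∀ g i, a (g, i) ∈ A g) {g : G} {f : FreeGr F G}
    (hf : f ∈ freeComponent F g) : FreeAlgebra.lift F a f ∈ A g := by
  suffices freeComponent F g ≤ (A g).comap (FreeAlgebra.lift F a).toLinearMap from this hf
  refine Submodule.span_le.2 ?_
  rintro _ ⟨w, rfl, rfl⟩
  simpa [map_list_prod, Function.comp_def] using
    SetLike.list_prod_map_mem_graded w Prod.fst a fun p _ => ha p.1 p.2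

theorem isGradedEndo_lift {a : G × ℕ → FreeGr F G} (ha : ∀ g i, a (g, i) ∈ freeComponent F g) :
    IsGradedEndo F (FreeAlgebra.lift F a) :=
  fun _ _ hf => lift_mem_of_mem_freeComponent ha hf

theorem isTIdeal_gradedIdentities {R : Type*} [Ring R] [Algebra F R] (A : G → Submodule F R)
    [SetLike.GradedMonoid A] : IsTIdeal F (gradedIdentities A) := by
  intro φ hφ f hf
  rw [mem_gradedIdentities] at hf ⊢
  intro a ha
  have lift_comp : (FreeAlgebra.lift F a).comp φ =
      FreeAlgebra.lift F fun q => FreeAlgebra.lift F a (φ (X F q.1 q.2)) := by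
    ext q
    simp [X]
  rw [← AlgHom.comp_apply, lift_comp]
  exact hf _ fun g i => lift_mem_of_mem_freeComponent ha (hφ g _ (X_mem_freeComponent g i))

theorem le_tIdealSpan_iff {J : TwoSidedIdeal (FreeGr F G)} {s : Set (FreeGr F G)} :
    J ≤ tIdealSpan F s ↔
      ∀ I : TwoSidedIdeal (FreeGr F G), IsTIdeal F I → (∀ f ∈ s, f ∈ I) → J ≤ I := by
  simp [tIdealSpan, le_sInf_iff]

theorem tIdealSpan_le {I : TwoSidedIdeal (FreeGr F G)} (hI : IsTIdeal F I) {s : Set (FreeGr F G)}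
    (hs : ∀ f ∈ s, f ∈ I) : tIdealSpan F s ≤ I :=
  sInf_le ⟨hI, hs⟩

section LieNilpotent

attribute [local instance] LieRing.ofAssociativeRing

theorem lie_lie_mem_of_isTIdeal {I : TwoSidedIdeal (FreeGr F G)} (hI : IsTIdeal F I)
    (h : ∀ p q r : G, ⁅⁅X F p 1, X F q 2⁆, X F r 3⁆ ∈ I) (a b c : FreeGr F G) :
    ⁅⁅a, b⁆, c⁆ ∈ I := by
  classical
  have homogeneous {p q r : G} {a b c : FreeGr F G} (ha : a ∈ freeComponent F p)
      (hb : b ∈ freeComponent F q) (hc : c ∈ freeComponent F r) : ⁅⁅a, b⁆, c⁆ ∈ I := by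
    let s : G × ℕ → FreeGr F G := Function.update (Function.update (Function.update
      (fun t => X F t.1 t.2) (p, 1) a) (q, 2) b) (r, 3) c
    have hs (g : G) (i : ℕ) : s (g, i) ∈ freeComponent F g := by
      simp only [s, Function.update_apply, Prod.mk.injEq]
      split_ifs with h₃ h₂ h₁
      · rwa [h₃.1]
      · rwa [h₂.1]
      · rwa [h₁.1]
      · exact X_mem_freeComponent g i
    simpa [Ring.lie_def, X, s] using hI _ (isGradedEndo_lift hs) _ (h p q r)
  have mem_iSup (x : FreeGr F G) : x ∈ ⨆ g, freeComponent F g :=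
    iSup_freeComponent (F := F) (G := G) ▸ Submodule.mem_top
  induction mem_iSup a using Submodule.iSup_induction' with
  | zero => simp
  | add a a' _ _ h h' => simpa using I.add_mem h h'
  | mem p a ha =>
  induction mem_iSup b using Submodule.iSup_induction' with
  | zero => simp
  | add b b' _ _ h h' => simpa using I.add_mem h h'
  | mem q b hb =>
  induction mem_iSup c using Submodule.iSup_induction' with
  | zero => simp
  | add c c' _ _ h h' => simpa using I.add_mem h h'
  | mem r c hc => exact homogeneous ha hb hc

end LieNilpotent

theorem lift_X_mem_of_isTIdeal {I : TwoSidedIdeal (FreeGr F G)} (hI : IsTIdeal F I) (σ : ℕ → ℕ)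
    {f : FreeGr F G} (hf : f ∈ I) :
    FreeAlgebra.lift F (fun q : G × ℕ => X F q.1 (σ q.2)) f ∈ I :=
  hI _ (isGradedEndo_lift fun g i => X_mem_freeComponent g (σ i)) f hf

end TIdeals

section Varieties

variable {F : Type*} [Field F] {V : Type*} [AddCommGroup V] [Module F V]

theorem identitiesV1_le_gradedIdentities (A : ℤ → Submodule F (ExteriorAlgebra F V))
    [SetLike.GradedMonoid A] : identitiesV1 F ≤ gradedIdentities A := by
  refine tIdealSpan_le (isTIdeal_gradedIdentities A) ?_
  rintro _ ⟨p, q, r, rfl⟩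
  rw [mem_gradedIdentities]
  intro a _
  simpa [Ring.lie_def, X] using exterior_lie_lie (a (p, 1)) (a (q, 2)) (a (r, 3))

theorem exists_injective_linearMap_of_not_finiteDimensional (hV : ¬ FiniteDimensional F V)
    (σ : Type*) [Countable σ] : ∃ φ : (σ →₀ F) →ₗ[F] V, Function.Injective φ := by
  let b := Module.Free.chooseBasis F V
  have : Infinite (Module.Free.ChooseBasisIndex F V) := by
    rw [← not_finite_iff_infinite]
    exact fun _ => hV (Module.Finite.of_basis b)
  obtain ⟨k, hk⟩ := exists_injective_nat σ
  exact ⟨Finsupp.linearCombination F (b ∘ Infinite.natEmbedding _ ∘ k),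
    b.linearIndependent.comp _ ((Infinite.natEmbedding _).injective.comp hk)⟩

theorem exists_injective_linearMap_ι_mem {N : Submodule F (ExteriorAlgebra F V)}
    (hN : ¬ FiniteDimensional F ↥(LinearMap.range (ExteriorAlgebra.ι F) ⊓ N))
    (σ : Type*) [Countable σ] :
    ∃ φ : (σ →₀ F) →ₗ[F] V, Function.Injective φ ∧ ∀ v, ExteriorAlgebra.ι F (φ v) ∈ N := by
  rw [← Submodule.map_comap_eq] at hN
  have comap_infinite : ¬ FiniteDimensional F ↥(N.comap (ExteriorAlgebra.ι F (M := V))) :=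
    fun _ => hN (Module.Finite.map _ _)
  obtain ⟨φ, hφ⟩ := exists_injective_linearMap_of_not_finiteDimensional comap_infinite σ
  exact ⟨Submodule.subtype _ ∘ₗ φ, Subtype.val_injective.comp hφ, fun v => (φ v).2⟩

variable [CharZero F]

theorem gradedIdentities_top_le_identitiesV1 (hV : ¬ FiniteDimensional F V) :
    gradedIdentities (fun _ : ℤ => (⊤ : Submodule F (ExteriorAlgebra F V))) ≤ identitiesV1 F := by
  refine le_tIdealSpan_iff.2 fun I hI hgen f hf => ?_
  obtain ⟨φ, hφ⟩ := exists_injective_linearMap_of_not_finiteDimensional hV (ℤ × ℕ)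
  rw [← mkₐ_eq_zero_iff F, ← lift_mkₐ_ι]
  refine lift_eq_zero_of_lie_lie (fun a b c => ?_) _ fun a => ?_
  · obtain ⟨a, rfl⟩ := RingCon.mkₐ_surjective (α := F) I.ringCon a
    obtain ⟨b, rfl⟩ := RingCon.mkₐ_surjective (α := F) I.ringCon b
    obtain ⟨c, rfl⟩ := RingCon.mkₐ_surjective (α := F) I.ringCon c
    simpa [Ring.lie_def] using
      (mkₐ_eq_zero_iff F).2 (lie_lie_mem_of_isTIdeal hI (fun p q r => hgen _ ⟨p, q, r, rfl⟩) a b c)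
  · rw [← map_eq_zero_iff (ExteriorAlgebra.map φ)
      (ExteriorAlgebra.map_injective_field (LinearMap.ker_eq_bot.2 hφ)), algHom_lift_apply]
    exact (mem_gradedIdentities _ f).1 hf _ fun _ _ => Submodule.mem_top

theorem gradedIdentities_coarsening_even_le_identitiesV2
    {A : ℤ → Submodule F (ExteriorAlgebra F V)} [SetLike.GradedMonoid A] {m : ℤ} (hm : Odd m)
    (hA : ¬ FiniteDimensional F ↥(LinearMap.range (ExteriorAlgebra.ι F) ⊓ A m)) :
    gradedIdentities (coarsening {r | Even r} A) ≤ identitiesV2 F := by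
  refine le_tIdealSpan_iff.2 fun I hI hgen f hf => ?_
  have rename (p q : ℤ × ℕ) {g : FreeGr F ℤ} (hg : g ∈ I) := lift_X_mem_of_isTIdeal hI
    (fun i => if i = 1 then p.2 else q.2) hg
  obtain ⟨φ, hφ, hφA⟩ := exists_injective_linearMap_ι_mem hA (ℤ × ℕ)
  rw [← mkₐ_eq_zero_iff F, ← lift_mkₐ_ι]
  refine lift_eq_zero_of_lift_eval_superGenerator (even := fun p : ℤ × ℕ => Even p.1)
    (fun p hp => ?_) (fun p q hp hq => ?_) fun c => ?_
  · refine Subring.mem_center_iff.2 fun r => (commute_mkₐ (fun q => ?_) r).symm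
    simpa [Ring.lie_def, X] using rename p q (hgen _ (.inl ⟨p.1, q.1, .inl hp, rfl⟩))
  · rw [← map_mul, ← map_mul, ← map_add, mkₐ_eq_zero_iff]
    simpa [X] using rename p q
      (hgen _ (.inr ⟨p.1, q.1, Int.not_even_iff_odd.1 hp, Int.not_even_iff_odd.1 hq, rfl⟩))
  · rw [← map_eq_zero_iff (ExteriorAlgebra.map φ)
      (ExteriorAlgebra.map_injective_field (LinearMap.ker_eq_bot.2 hφ)), algHom_lift_apply]
    refine (mem_gradedIdentities _ f).1 hf _ fun g i => ?_
    by_cases hg : Even g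
    · refine le_coarsening A (r := 0) (by simpa using hg) ?_
      simpa [superGenerator, hg, Algebra.algebraMap_eq_smul_one] using
        Submodule.smul_mem _ (c (g, i)) (SetLike.GradedOne.one_mem (A := A))
    · refine le_coarsening A (r := m) ((Int.not_even_iff_odd.1 hg).sub_odd hm) ?_
      simpa [superGenerator, hg] using hφA _

end Varieties

end GradedGrassmann

open GradedGrassmann in
theorem theorem5p3_general (F : Type*) [Field F] [CharZero F] {V : Type*} [AddCommGroup V]
    [Module F V] (A : ℤ → Submodule F (ExteriorAlgebra F V)) [SetLike.GradedMonoid A]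
    (hA : ⨆ r, A r = ⊤) :
    ((∀ h, Even h → HasFaithfulCentralSquareZero (A h)) →
      ∀ B : Subalgebra F (ExteriorAlgebra F V), gradedIdentities A ≤
        TwoSidedIdeal.comap (reduceMod2 F)
          (gradedIdentities (inducedMod2 (restrictGrading B A)))) ∧
    (∀ m n : ℤ, m < 0 → 0 < n → Int.gcd m n = 1 →
      ¬ FiniteDimensional F ↥(LinearMap.range (ExteriorAlgebra.ι F) ⊓ A m) →
      ¬ FiniteDimensional F ↥(LinearMap.range (ExteriorAlgebra.ι F) ⊓ A n) →
      (Even (m * n) ∧ gradedIdentities A = identitiesV1 F) ∨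
        (Odd (m * n) ∧ gradedIdentities A ≤ identitiesV2 F)) := by
  let _ := Module.compHom (ExteriorAlgebra F V) (algebraMap ℚ F)
  have : IsAddTorsionFree (ExteriorAlgebra F V) := IsAddTorsionFree.of_module_rat _
  refine ⟨fun hcentral B => ?_, fun m n hm hn hmn hAm hAn => ?_⟩
  · calc gradedIdentities A
        ≤ gradedIdentities (coarsening {r | Even r} A) := gradedIdentities_le_coarsening hcentral
      _ ≤ TwoSidedIdeal.comap (reduceMod2 F) (gradedIdentities (inducedMod2 A)) :=
          gradedIdentities_coarsening_even_le A
      _ ≤ TwoSidedIdeal.comap (reduceMod2 F)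
            (gradedIdentities (inducedMod2 (restrictGrading B A))) :=
          (TwoSidedIdeal.comap (reduceMod2 F)).monotone (gradedIdentities_le_restrict B A)
  have hcentral {h : ℤ} (hpar : Even h ∨ Even (m * n)) : HasFaithfulCentralSquareZero (A h) :=
    hasFaithfulCentralSquareZero_of_gcd_eq_one hm hn hmn hAm hAn hpar
  rcases Int.even_or_odd (m * n) with h | h
  · refine .inl ⟨h, le_antisymm ?_ (identitiesV1_le_gradedIdentities A)⟩
    refine (gradedIdentities_le_coarsening (H := Set.univ) fun k _ => hcentral (.inr h)).trans ?_
    rw [funext (coarsening_univ hA)]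
    exact gradedIdentities_top_le_identitiesV1 fun _ => hAm inferInstance
  · exact .inr ⟨h, (gradedIdentities_le_coarsening fun k hk => hcentral (.inl hk)).trans
      (gradedIdentities_coarsening_even_le_identitiesV2 (Int.odd_mul.1 h).1 hAm)⟩

theorem theorem5p3 (F : Type*) [Field F] [CharZero F]
    (A : ℤ → Submodule F (GradedGrassmann.E F)) [GradedAlgebra A] :
    (∀ S : Set ℕ, S.Infinite →
      (∀ i ∈ S, ∃ r : ℤ, GradedGrassmann.e F i ∈ A r) →
      GradedGrassmann.IsCentral S
        (GradedGrassmann.restrictGrading (GradedGrassmann.subGrassmann F S) A) →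
      GradedGrassmann.gradedIdentities A ≤
        TwoSidedIdeal.comap (GradedGrassmann.reduceMod2 F)
          (GradedGrassmann.gradedIdentities (GradedGrassmann.inducedMod2
            (GradedGrassmann.restrictGrading (GradedGrassmann.subGrassmann F S) A)))) ∧
    (∀ m n : ℤ, m < 0 → 0 < n → Int.gcd m n = 1 →
      ¬ FiniteDimensional F ↥(GradedGrassmann.L F ⊓ A m) →
      ¬ FiniteDimensional F ↥(GradedGrassmann.L F ⊓ A n) →
      (Even (m * n) ∧
          GradedGrassmann.gradedIdentities A = GradedGrassmann.identitiesV1 F) ∨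
        (Odd (m * n) ∧
          GradedGrassmann.gradedIdentities A ≤ GradedGrassmann.identitiesV2 F)) := by
  have general := theorem5p3_general F A
    (DirectSum.Decomposition.isInternal A).submodule_iSup_eq_top
  exact ⟨fun S _ _ hS => general.1 (fun _ => hS.hasFaithfulCentralSquareZero) _, general.2⟩
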